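/- Let $\Sigma$ be a positive semidefinite $2\times 2$ real matrix with positive diagonal entries, and let $X=(X_1,X_2)^T$ and $Y=(Y_1,Y_2)^T$ be independent $\mathcal{N}_2(0,\Sigma)$ random vectors, that is, normal random vectors with mean zero and covariance matrix $\Sigma$. If $p_1,p_2$ are nonnegative real numbers such that $p_1+p_2=1$, then the random variable \[ p_1\frac{Y_1}{X_1}+p_2\frac{Y_2}{X_2} \] has the standard Cauchy distribution, that is, the distribution with density $x\mapsto \frac{1}{\pi(1+x^2)}$ on $\mathbb{R}$. -/

import Mathlib

open MeasureTheory ProbabilityTheory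

/-!
Put `w k = X k + i Y k`. Since `(X, Y)` is a centered Gaussian pair with independent, identically
distributed components, the complex vector `w` has the same law as `e^{iθ} w` for every `θ`. The
ratio `Y k / X k` is the value at the point `w k / conj (w k)` of the unit circle of the map
`z ↦ i (1 - z) / (1 + z)` from the disc to the upper half-plane. Replacing `w` by `e^{iφ/2} w`
rotates all these points by `φ`, so the average over `φ` of `exp (i t ∑ p k Y k / X k)`, for
`0 ≤ t`, is the average over the circle of the boundary values of a bounded holomorphic function
on the disc. By the mean value property it equals the value at the centre, where each ratio
becomes `i`: this is `exp (-t)`, whatever `w` and the convex weights `p` are. The same computation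
with a single weight gives the characteristic function of the Cauchy distribution, as the law of
`tan θ` for uniform `θ`.
-/

open Complex Filter Function Metric Set
open scoped ComplexConjugate Real Topology

section MeanValue

lemma circleMap_mem_ball (c : ℂ) {r R : ℝ} (hr : |r| < R) (θ : ℝ) :
    circleMap c r θ ∈ ball c R := by
  simpa [mem_ball, dist_eq_norm] using hr

lemma eventually_abs_lt_nhdsLT {R : ℝ} (hR : 0 < R) : ∀ᶠ r in 𝓝[<] R, |r| < R := by
  filter_upwards [Ioo_mem_nhdsLT (neg_lt_self hR)] with r hr using abs_lt.2 hr

lemma tendsto_circleMap_nhdsWithin_ball (c : ℂ) {R : ℝ} (hR : 0 < R) (θ : ℝ) :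
    Tendsto (fun r ↦ circleMap c r θ) (𝓝[<] R) (𝓝[ball c R] circleMap c R θ) := by
  refine tendsto_nhdsWithin_of_tendsto_nhds_of_eventually_within _ ?_ ?_
  · have hcont : Continuous fun r : ℝ ↦ circleMap c r θ := by unfold circleMap; fun_prop
    exact hcont.continuousAt.mono_left nhdsWithin_le_nhds
  · filter_upwards [eventually_abs_lt_nhdsLT hR] with r hr using circleMap_mem_ball c hr θ

lemma circleAverage_eq_of_bounded_of_continuousWithinAt_off_countable {E : Type*}
    [NormedAddCommGroup E] [NormedSpace ℂ E] [CompleteSpace E] {f : ℂ → E} {c : ℂ} {R M : ℝ}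
    {s : Set ℂ} (hR : 0 < R) (hs : s.Countable) (hd : DifferentiableOn ℂ f (ball c R))
    (hM : ∀ z ∈ ball c R, ‖f z‖ ≤ M)
    (hc : ∀ z ∈ sphere c R \ s, ContinuousWithinAt f (ball c R) z) :
    Real.circleAverage f c R = f c := by
  have hlim : Tendsto (fun r ↦ Real.circleAverage f c r) (𝓝[<] R)
      (𝓝 (Real.circleAverage f c R)) := by
    refine (intervalIntegral.tendsto_integral_filter_of_dominated_convergence (fun _ ↦ M)
      ?_ ?_ intervalIntegrable_const ?_).const_smul _
    · filter_upwards [eventually_abs_lt_nhdsLT hR] with r hr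
      exact (hd.continuousOn.comp_continuous (continuous_circleMap c r)
        (circleMap_mem_ball c hr)).aestronglyMeasurable
    · filter_upwards [eventually_abs_lt_nhdsLT hR] with r hr
      exact .of_forall fun θ _ ↦ hM _ (circleMap_mem_ball c hr θ)
    · filter_upwards [measure_eq_zero_iff_ae_notMem.mp
        ((hs.preimage_circleMap c hR.ne').measure_zero volume)] with θ hθ _
      exact (hc _ ⟨circleMap_mem_sphere c hR.le θ, hθ⟩).tendsto.comp
        (tendsto_circleMap_nhdsWithin_ball c hR θ)
  refine tendsto_nhds_unique hlim (tendsto_const_nhds.congr' ?_)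
  filter_upwards [eventually_abs_lt_nhdsLT hR] with r hr
  exact (hd.diffContOnCl_ball (closedBall_subset_ball hr)).circleAverage.symm

end MeanValue

section InvCayley

/-- The inverse Cayley transform, mapping the unit disc to the upper half-plane and its centre to
`I`. On the unit circle it sends `e^{2iθ}` to `tan θ`; at the pole `-1` division by zero gives the
value `0`, which is also the value of `Real.tan` at `π / 2`. -/
noncomputable def invCayley (z : ℂ) : ℂ := I * (1 - z) / (1 + z)

lemma invCayley_zero : invCayley 0 = I := by simp [invCayley]

lemma im_invCayley (z : ℂ) : (invCayley z).im = (1 - ‖z‖ ^ 2) / normSq (1 + z) := by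
  rw [invCayley, mul_div_assoc, I_mul_im, div_re, ← add_div, Complex.sq_norm, normSq_apply z]
  congr 1
  simp only [add_re, sub_re, one_re, add_im, sub_im, one_im]
  ring

lemma im_invCayley_nonneg {z : ℂ} (hz : ‖z‖ ≤ 1) : 0 ≤ (invCayley z).im := by
  rw [im_invCayley]
  exact div_nonneg (sub_nonneg.2 (pow_le_one₀ (norm_nonneg z) hz)) (normSq_nonneg _)

lemma differentiableAt_invCayley {z : ℂ} (hz : z ≠ -1) : DifferentiableAt ℂ invCayley z := by
  have hden : 1 + z ≠ 0 := fun h ↦ hz (eq_neg_of_add_eq_zero_right h)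
  unfold invCayley
  fun_prop (disch := assumption)

lemma invCayley_div_conj {w : ℂ} (hw : w ≠ 0) : invCayley (w / conj w) = (w.im / w.re : ℝ) := by
  have hw' : conj w ≠ 0 := by simpa using hw
  calc invCayley (w / conj w)
    _ = I * (conj w - w) / (conj w + w) := by
      rw [invCayley, one_sub_div hw', one_add_div hw', ← mul_div_assoc,
        div_div_div_cancel_right₀ hw']
    _ = 2 * w.im / (2 * w.re) := by
      congr 1
      · rw [← neg_sub, sub_conj]; push_cast; linear_combination (-2 * w.im) * I_sq
      · rw [add_comm, add_conj]; push_cast; rfl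
    _ = (w.im / w.re : ℝ) := by rw [mul_div_mul_left _ _ two_ne_zero]; push_cast; rfl

lemma exp_mul_div_conj (θ : ℝ) (w : ℂ) :
    cexp (θ * I) * w / conj (cexp (θ * I) * w) = circleMap 0 1 (2 * θ) * (w / conj w) := by
  rw [map_mul, ← exp_conj, map_mul, conj_ofReal, conj_I, mul_div_mul_comm, ← Complex.exp_sub]
  simp only [circleMap, zero_add, ofReal_one, one_mul]
  congr 2
  push_cast
  ring

lemma invCayley_circleMap_mul_div_conj (θ : ℝ) {w : ℂ} (hw : w ≠ 0) :
    invCayley (circleMap 0 1 (2 * θ) * (w / conj w)) =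
      ((cexp (θ * I) * w).im / (cexp (θ * I) * w).re : ℝ) := by
  rw [← exp_mul_div_conj, invCayley_div_conj (mul_ne_zero (exp_ne_zero _) hw)]

lemma invCayley_circleMap (θ : ℝ) : invCayley (circleMap 0 1 (2 * θ)) = (Real.tan θ : ℝ) := by
  simpa [exp_ofReal_mul_I_im, exp_ofReal_mul_I_re, ← Complex.ofReal_tan,
    Real.tan_eq_sin_div_cos] using invCayley_circleMap_mul_div_conj θ one_ne_zero

lemma circleAverage_cexp_sum_invCayley {ι : Type*} [Fintype ι] {p : ι → ℝ} (hp : ∀ i, 0 ≤ p i)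
    (hsum : ∑ i, p i = 1) {c : ι → ℂ} (hc : ∀ i, ‖c i‖ ≤ 1) {t : ℝ} (ht : 0 ≤ t) :
    Real.circleAverage (fun u ↦ cexp (t * (∑ i, p i * invCayley (u * c i)) * I)) 0 1 =
      cexp (-t) := by
  have hdisc {u : ℂ} (hu : u ∈ ball (0 : ℂ) 1) (i : ι) : ‖u * c i‖ < 1 := by
    rw [norm_mul]
    exact mul_lt_one_of_nonneg_of_lt_one_left (norm_nonneg u) (by simpa using hu) (hc i)
  have hdiff {u : ℂ} (hu : ∀ i, u * c i ≠ -1) :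
      DifferentiableAt ℂ (fun u ↦ cexp (t * (∑ i, p i * invCayley (u * c i)) * I)) u := by
    have hterm (i : ι) : DifferentiableAt ℂ (fun u ↦ p i * invCayley (u * c i)) u :=
      ((differentiableAt_invCayley (hu i)).comp u (differentiableAt_id.mul_const (c i))).const_mul _
    exact (((DifferentiableAt.fun_sum fun i _ ↦ hterm i).const_mul _).mul_const _).cexp
  rw [circleAverage_eq_of_bounded_of_continuousWithinAt_off_countable (M := 1)
    (s := range fun i ↦ -(c i)⁻¹) one_pos (finite_range _).countable]
  · have hsum' : ∑ i, (p i : ℂ) = 1 := by exact_mod_cast hsum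
    simp [invCayley_zero, ← Finset.sum_mul, hsum', mul_assoc]
  · refine fun u hu ↦ (hdiff fun i h ↦ ?_).differentiableWithinAt
    simpa [h] using hdisc hu i
  · intro u hu
    rw [norm_exp, Real.exp_le_one_iff]
    have him : 0 ≤ ∑ i, p i * (invCayley (u * c i)).im :=
      Finset.sum_nonneg fun i _ ↦ mul_nonneg (hp i) (im_invCayley_nonneg (hdisc hu i).le)
    simpa using mul_nonneg ht him
  · refine fun u hu ↦ (hdiff fun i h ↦ hu.2 ⟨i, ?_⟩).continuousAt.continuousWithinAt
    have hci : c i ≠ 0 := fun h0 ↦ by simp [h0] at h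
    rw [eq_div_of_mul_eq hci h, neg_div, one_div]

end InvCayley

section Cauchy

variable {E : Type*} [NormedAddCommGroup E] [NormedSpace ℝ E]

lemma integral_cauchyMeasure_eq_integral_tan (f : ℝ → E) :
    ∫ x, f x ∂cauchyMeasure 0 1 = π⁻¹ • ∫ θ in -(π / 2)..π / 2, f (Real.tan θ) := by
  have hsubst := integral_image_eq_integral_abs_deriv_smul MeasurableSet.univ
    (fun x _ ↦ (Real.hasDerivAt_arctan x).hasDerivWithinAt) Real.arctan_injective.injOn
    (fun θ ↦ f (Real.tan θ))
  rw [image_univ, Real.range_arctan, setIntegral_univ] at hsubst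
  rw [intervalIntegral.integral_of_le (by linarith [Real.pi_pos]), integral_Ioc_eq_integral_Ioo,
    hsubst, ← integral_smul, cauchyMeasure_of_scale_ne_zero 0 one_ne_zero,
    integral_withDensity_eq_integral_toReal_smul (measurable_cauchyPDF 0 1)
      (.of_forall fun x ↦ ENNReal.ofReal_lt_top)]
  refine integral_congr_ae (.of_forall fun x ↦ ?_)
  have hpdf : (cauchyPDF 0 1 x).toReal = π⁻¹ * |1 / (1 + x ^ 2)| := by
    rw [cauchyPDF_def, ENNReal.toReal_ofReal (cauchyPDF_pos 0 one_ne_zero x).le,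
      cauchyPDFReal_def, abs_of_pos (by positivity)]
    simp [add_comm]
  simp only [hpdf, Real.tan_arctan, smul_smul]

lemma integral_cauchyMeasure_eq_circleAverage (f : ℂ → E) :
    ∫ x : ℝ, f x ∂cauchyMeasure 0 1 = Real.circleAverage (fun u ↦ f (invCayley u)) 0 1 := by
  rw [integral_cauchyMeasure_eq_integral_tan, Real.circleAverage_eq_integral_add (-π),
    intervalIntegral.integral_comp_add_right (fun θ ↦ f (invCayley (circleMap 0 1 θ)))]
  simp only [← invCayley_circleMap]
  rw [intervalIntegral.integral_comp_mul_left (fun θ ↦ f (invCayley (circleMap 0 1 θ)))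
    two_ne_zero, smul_smul, ← mul_inv_rev]
  congr 2 <;> ring

lemma charFun_cauchyMeasure_of_nonneg {t : ℝ} (ht : 0 ≤ t) :
    charFun (cauchyMeasure 0 1) t = cexp (-t) := by
  rw [charFun_apply_real, integral_cauchyMeasure_eq_circleAverage (fun z ↦ cexp (t * z * I))]
  simpa using circleAverage_cexp_sum_invCayley (ι := Unit) (p := 1) (c := 1)
    (fun _ ↦ zero_le_one) (by simp) (by simp) ht

lemma measure_ext_of_charFun_of_nonneg {μ ν : Measure ℝ} [IsFiniteMeasure μ] [IsFiniteMeasure ν]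
    (h : ∀ t, 0 ≤ t → charFun μ t = charFun ν t) : μ = ν := by
  refine Measure.ext_of_charFun (funext fun t ↦ ?_)
  rcases le_total 0 t with ht | ht
  · exact h t ht
  · rw [← neg_neg t, charFun_neg, charFun_neg (-t), h (-t) (neg_nonneg.2 ht)]

end Cauchy

lemma integral_integral_comp_of_map_eq {α β Θ E : Type*} [MeasurableSpace α] [MeasurableSpace β]
    [MeasurableSpace Θ] [NormedAddCommGroup E] [NormedSpace ℝ E] {μ : Measure α} [SFinite μ]
    {μ' : Measure β} [SFinite μ'] {ν : Measure Θ} [IsFiniteMeasure ν] {T : Θ → α → β}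
    (hT : Measurable (uncurry T)) (hmap : ∀ᵐ θ ∂ν, μ.map (T θ) = μ') {f : β → E}
    (hf : Integrable f μ') :
    ∫ x, ∫ θ, f (T θ x) ∂ν ∂μ = ν.real univ • ∫ y, f y ∂μ' := by
  have hpres := (MeasurePreserving.id ν).skew_product hT hmap
  have hint : Integrable (fun q : Θ × β ↦ f q.2) (ν.prod μ') := hf.comp_snd ν
  calc ∫ x, ∫ θ, f (T θ x) ∂ν ∂μ
    _ = ∫ q, f (T q.1 q.2) ∂ν.prod μ :=
      (integral_prod_symm _ (hpres.integrable_comp_of_integrable hint)).symm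
    _ = ∫ q, f q.2 ∂ν.prod μ' := by
      rw [← hpres.map_eq, integral_map hpres.measurable.aemeasurable
        (hpres.map_eq ▸ hint.aestronglyMeasurable)]
    _ = ν.real univ • ∫ y, f y ∂μ' := integral_fun_snd f

section CircularlySymmetric

variable {ι : Type*} [Fintype ι] {p : ι → ℝ} {ν : Measure (ι → ℂ)} [IsProbabilityMeasure ν]
  [SMulInvariantMeasure Circle (ι → ℂ) ν]

lemma integral_cexp_sum_im_div_re (h0 : ∀ i, ∀ᵐ w ∂ν, w i ≠ 0) (hp : ∀ i, 0 ≤ p i)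
    (hsum : ∑ i, p i = 1) {t : ℝ} (ht : 0 ≤ t) :
    ∫ w, cexp (t * (∑ i, p i * ((w i).im / (w i).re) : ℝ) * I) ∂ν = cexp (-t) := by
  set f : (ι → ℂ) → ℂ := fun w ↦ cexp (t * (∑ i, p i * ((w i).im / (w i).re) : ℝ) * I) with hf_def
  have hf : Integrable f ν := by
    refine .of_bound (C := 1) (by fun_prop) (.of_forall fun w ↦ ?_)
    simp only [hf_def]
    rw [← ofReal_mul, norm_exp_ofReal_mul_I]
  have hrotate {w : ι → ℂ} (hw : ∀ i, w i ≠ 0) (φ : ℝ) : f (Circle.exp (φ / 2) • w) =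
      cexp (t * (∑ i, p i * invCayley (circleMap 0 1 φ * (w i / conj (w i)))) * I) := by
    have hslope (i : ι) := invCayley_circleMap_mul_div_conj (φ / 2) (hw i)
    rw [mul_div_cancel₀ _ (two_ne_zero' ℝ)] at hslope
    simp only [hf_def, hslope, ofReal_sum, ofReal_mul, Pi.smul_apply, Circle.smul_def,
      Circle.coe_exp, smul_eq_mul]
  have horbit : ∀ᵐ w ∂ν, ∫ φ in Ioc 0 (2 * π), f (Circle.exp (φ / 2) • w) =
      (2 * π) • cexp (-t) := by
    filter_upwards [ae_all_iff.2 h0] with w hw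
    have hunit (i : ι) : ‖w i / conj (w i)‖ ≤ 1 := by simp [hw i]
    rw [← circleAverage_cexp_sum_invCayley hp hsum hunit ht, Real.circleAverage_def,
      smul_inv_smul₀ (by positivity), intervalIntegral.integral_of_le (by positivity)]
    simp only [hrotate hw]
  have hmeas : Measurable (uncurry fun (φ : ℝ) (w : ι → ℂ) ↦ Circle.exp (φ / 2) • w) := by
    refine Continuous.measurable ?_
    unfold uncurry
    fun_prop
  have haverage := integral_integral_comp_of_map_eq (ν := volume.restrict (Ioc 0 (2 * π))) hmeas
    (.of_forall fun φ ↦ (measurePreserving_smul _ ν).map_eq) hf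
  rw [integral_congr_ae horbit] at haverage
  refine (smul_right_injective ℂ Real.two_pi_pos.ne' ?_).symm
  simpa [Real.pi_pos.le] using haverage

lemma hasLaw_sum_im_div_re (h0 : ∀ i, ∀ᵐ w ∂ν, w i ≠ 0) (hp : ∀ i, 0 ≤ p i)
    (hsum : ∑ i, p i = 1) :
    HasLaw (fun w ↦ ∑ i, p i * ((w i).im / (w i).re)) (cauchyMeasure 0 1) ν := by
  have hmeas : Measurable fun w : ι → ℂ ↦ ∑ i, p i * ((w i).im / (w i).re) := by fun_prop
  refine ⟨hmeas.aemeasurable, measure_ext_of_charFun_of_nonneg fun t ht ↦ ?_⟩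
  rw [charFun_cauchyMeasure_of_nonneg ht, charFun_apply_real,
    integral_map hmeas.aemeasurable (by fun_prop)]
  exact integral_cexp_sum_im_div_re h0 hp hsum ht

end CircularlySymmetric

section ComplexPairing

variable {ι E : Type*} [NormedAddCommGroup E] [NormedSpace ℝ E]

/-- The values of real functionals `L i`, extended complex-linearly, at the point `x + i y` of the
complexification of `E`, which is represented by the pair `(x, y)`. -/
noncomputable def complexPairing (L : ι → StrongDual ℝ E) (z : E × E) : ι → ℂ :=
  fun i ↦ L i z.1 + L i z.2 * I

lemma complexPairing_rotation (L : ι → StrongDual ℝ E) (θ : ℝ) (z : E × E) :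
    complexPairing L (ContinuousLinearMap.rotation (-θ) z) =
      Circle.exp θ • complexPairing L z := by
  ext i
  simp only [complexPairing, ContinuousLinearMap.rotation_apply, Real.cos_neg, Real.sin_neg,
    neg_neg, neg_smul, map_add, map_neg, map_smul, smul_eq_mul, Pi.smul_apply, Circle.smul_def,
    Circle.coe_exp, exp_mul_I]
  push_cast
  linear_combination -sin θ * L i z.2 * I_sq

variable [MeasurableSpace E] [BorelSpace E]

lemma measurable_complexPairing (L : ι → StrongDual ℝ E) : Measurable (complexPairing L) := by
  unfold complexPairing
  fun_prop

end ComplexPairing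

section Gaussian

variable {ι : Type*}

section Banach

variable {E : Type*} [NormedAddCommGroup E] [NormedSpace ℝ E] [SecondCountableTopology E]
  [CompleteSpace E] [MeasurableSpace E] [BorelSpace E] {μ : Measure E} [IsGaussian μ]

lemma smulInvariantMeasure_map_complexPairing (hμ : μ[id] = 0) (L : ι → StrongDual ℝ E) :
    SMulInvariantMeasure Circle (ι → ℂ) ((μ.prod μ).map (complexPairing L)) := by
  refine ⟨fun u s hs ↦ ?_⟩
  obtain ⟨θ, rfl⟩ := Circle.exp_surjective u
  have hL := measurable_complexPairing L
  have hsmul : Measurable fun w : ι → ℂ ↦ Circle.exp θ • w :=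
    measurable_pi_lambda _ fun i ↦ (measurable_pi_apply i).const_smul (Circle.exp θ)
  have hcomp : (Circle.exp θ • ·) ∘ complexPairing L =
      complexPairing L ∘ ContinuousLinearMap.rotation (-θ) :=
    funext fun z ↦ (complexPairing_rotation L θ z).symm
  rw [← Measure.map_apply hsmul hs, Measure.map_map hsmul hL, hcomp,
    ← Measure.map_map hL (by fun_prop), IsGaussian.map_rotation_eq_self hμ]

lemma hasLaw_sum_ratio_of_isGaussian [Fintype ι] (hμ : μ[id] = 0) {L : ι → StrongDual ℝ E}
    (hL : ∀ i, ∀ᵐ x ∂μ, L i x ≠ 0) {p : ι → ℝ} (hp : ∀ i, 0 ≤ p i) (hsum : ∑ i, p i = 1) :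
    HasLaw (fun z : E × E ↦ ∑ i, p i * (L i z.2 / L i z.1)) (cauchyMeasure 0 1) (μ.prod μ) := by
  have hpair : HasLaw (complexPairing L) ((μ.prod μ).map (complexPairing L)) (μ.prod μ) :=
    ⟨(measurable_complexPairing L).aemeasurable, rfl⟩
  have := smulInvariantMeasure_map_complexPairing hμ L
  have := hpair.isProbabilityMeasure_iff.1 inferInstance
  have h0 (i : ι) : ∀ᵐ w ∂(μ.prod μ).map (complexPairing L), w i ≠ 0 := by
    refine (hpair.ae_iff (by fun_prop)).1 ?_
    filter_upwards [Measure.quasiMeasurePreserving_fst.ae (hL i)] with z hz hw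
    exact hz (by simpa [complexPairing] using congrArg re hw)
  simpa [complexPairing] using (hasLaw_sum_im_div_re h0 hp hsum).fun_comp hpair

end Banach

variable [Fintype ι] [DecidableEq ι]

lemma ae_apply_ne_zero_multivariateGaussian {m : EuclideanSpace ℝ ι} {S : Matrix ι ι ℝ}
    (hS : S.PosSemidef) {i : ι} (hi : 0 < S i i) :
    ∀ᵐ x ∂multivariateGaussian m S, x i ≠ 0 := by
  have := nullSingletonClass_gaussianReal (μ := m i) (v := (S i i).toNNReal) (by simpa using hi)
  exact (measurePreserving_eval_multivariateGaussian hS).quasiMeasurePreserving.ae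
    (Measure.ae_ne _ 0)

theorem corollary3p3_general {Ω : Type*} [MeasurableSpace Ω] (P : Measure Ω)
    (S : Matrix ι ι ℝ) (hS : S.PosSemidef) (hdiag : ∀ i, 0 < S i i)
    (X Y : Ω → EuclideanSpace ℝ ι)
    (hX : HasLaw X (multivariateGaussian 0 S) P)
    (hY : HasLaw Y (multivariateGaussian 0 S) P)
    (hXY : IndepFun X Y P)
    (p : ι → ℝ) (hp : ∀ i, 0 ≤ p i) (hsum : ∑ i, p i = 1) :
    HasLaw (fun ω ↦ ∑ i, p i * (Y ω i / X ω i)) (cauchyMeasure 0 1) P := by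
  have := hX.isProbabilityMeasure
  have hL (i : ι) : ∀ᵐ x ∂multivariateGaussian 0 S, EuclideanSpace.proj (𝕜 := ℝ) i x ≠ 0 :=
    ae_apply_ne_zero_multivariateGaussian hS (hdiag i)
  exact (hasLaw_sum_ratio_of_isGaussian integral_id_multivariateGaussian' hL hp hsum).fun_comp
    (hXY.hasLaw_prod hX hY)

end Gaussian

theorem corollary3p3 {Ω : Type*} [MeasurableSpace Ω] (P : Measure Ω) [IsProbabilityMeasure P]
    (S : Matrix (Fin 2) (Fin 2) ℝ) (hS : S.PosSemidef) (hdiag : ∀ i, 0 < S i i)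
    (X Y : Ω → EuclideanSpace ℝ (Fin 2))
    (hX : HasLaw X (multivariateGaussian 0 S) P)
    (hY : HasLaw Y (multivariateGaussian 0 S) P)
    (hXY : IndepFun X Y P)
    (p₁ p₂ : ℝ) (hp₁ : 0 ≤ p₁) (hp₂ : 0 ≤ p₂) (hp : p₁ + p₂ = 1) :
    HasLaw (fun ω => p₁ * (Y ω 0 / X ω 0) + p₂ * (Y ω 1 / X ω 1)) (cauchyMeasure 0 1) P := by
  simpa using corollary3p3_general P S hS hdiag X Y hX hY hXY ![p₁, p₂]
    (by simp [Fin.forall_fin_two, hp₁, hp₂]) (by simpa using hp)
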